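/- Let $\mathcal H=\bigotimes_r\mathcal H^{(r)}$ be a tensor product of finitely many finite-dimensional complex Hilbert spaces, one for each party $r$, and let $\rho_1,\dots,\rho_N$ be density operators on $\mathcal H$ (positive semidefinite, trace $1$). A *finite LOCC protocol* is a finite rooted tree. At each inner node one party $r$, chosen depending on the course of the protocol so far, applies a local measurement with finitely many outcomes, given by Kraus operators $A_k$ with $\sum_k A_k^\dagger A_k=\mathbb 1$ from its current finite-dimensional space to finite-dimensional spaces (so that local ancillas may be adjoined and discarded). The children of the node correspond to the outcomes $k$, and the outcome is announced to all parties. Each leaf $l$ has an effect $F_l=A_{(l)}^\dagger A_{(l)}$, where the product operator $A_{(l)}$ is the composition of the Kraus operators along the path from the root to $l$. A *finite LOCC measurement* is a family of effects $(E_k)_{k=1}^n$ of the form $E_k=\sum_l\pi_{k|l}F_l$ for a finite LOCC protocol and a classical post-processing $\pi_{k|l}\ge 0$, $\sum_k\pi_{k|l}=1$. Let $p_1,\dots,p_N>0$ with $\sum_\mu p_\mu=1$ be arbitrary a priori probabilities, and let $$\hat d_{\mathrm{mf}}=\inf_{(E_k)}\Bigl(1-\sum_k\max_\mu p_\mu\operatorname{tr}(\rho_\mu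 E_k)\Bigr),$$ where the infimum is taken over all finite LOCC measurements. Suppose that $\bigcap_\mu\ker\rho_\mu$ contains no product vector $\bigotimes_r v^{(r)}$ except $0$. If $(\rho_\mu)$ can be discriminated perfectly by asymptotic LOCC, i.e. if $\hat d_{\mathrm{mf}}=0$, then for every $\chi$ with $1/N\le\chi\le 1$ there exists a product operator $E=\bigotimes_r E^{(r)}\ge 0$ on $\mathcal H$ such that $\sum_\mu\operatorname{tr}(E\rho_\mu)=1$, $\max_\mu\operatorname{tr}(E\rho_\mu)=\chi$, and $\operatorname{tr}(E\rho_\mu E\rho_\nu)=0$ for all $\mu\ne\nu$. -/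

import Mathlib

open scoped Matrix ComplexOrder

namespace AsymptoticLOCC

noncomputable section

/-- The index set of the standard product basis of `⨂ r, ℂ ^ d r`. Operators on the
multipartite space are matrices over this index set. -/
abbrev Idx {ι : Type*} (d : ι → ℕ) : Type _ := ∀ r, Fin (d r)

/-- The tensor product `⨂ r, F r` of (possibly rectangular) matrices, in the product bases. -/
def tensorOp {ι : Type*} [Fintype ι] {e d : ι → ℕ}
    (F : ∀ r, Matrix (Fin (e r)) (Fin (d r)) ℂ) : Matrix (Idx e) (Idx d) ℂ :=
  Matrix.of fun i j => ∏ r, F r (i r) (j r)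

/-- `E = ⨂ r, F r` for some operators `F r` on the local spaces. -/
def IsProductOperator {ι : Type*} [Fintype ι] {d : ι → ℕ}
    (E : Matrix (Idx d) (Idx d) ℂ) : Prop :=
  ∃ F : ∀ r, Matrix (Fin (d r)) (Fin (d r)) ℂ, E = tensorOp F

/-- `v = ⨂ r, w r` for some vectors `w r` of the local spaces. -/
def IsProductVector {ι : Type*} [Fintype ι] {d : ι → ℕ} (v : Idx d → ℂ) : Prop :=
  ∃ w : ∀ r, Fin (d r) → ℂ, v = fun i => ∏ r, w r (i r)

/-- Density operators. -/
def IsState {κ : Type*} [Fintype κ] (ρ : Matrix κ κ ℂ) : Prop :=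
  ρ.PosSemidef ∧ ρ.trace = 1

/-- An operator from the local space `ℂ ^ n` to some finite-dimensional space `ℂ ^ m`. The
output dimension is free, so that a party may adjoin or discard finite-dimensional ancillas. -/
abbrev LocalOp (n : ℕ) : Type := Σ m : ℕ, Matrix (Fin m) (Fin n) ℂ

/-- `Protocol d B` is the type of finite protocol trees that start at a node at which the
product operator `⨂ r, B r` has already been applied to the input space `⨂ r, ℂ ^ d r`.

* `halt`: the node is a leaf.
* `step`: party `r` performs a local measurement with finitely many outcomes `k` and Kraus
  operators `A k` on its current space. The outcome is known to all parties, and the protocol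
  goes on in a way that may depend on it. -/
inductive Protocol {ι : Type*} [DecidableEq ι] (d : ι → ℕ) : (∀ r, LocalOp (d r)) → Type _
  | halt (B : ∀ r, LocalOp (d r)) : Protocol d B
  | step (B : ∀ r, LocalOp (d r)) (r : ι) (m : ℕ) (e : Fin m → ℕ)
      (A : ∀ k, Matrix (Fin (e k)) (Fin (B r).1) ℂ)
      (hA : ∑ k, (A k)ᴴ * A k = 1)
      (next : ∀ k, Protocol d (Function.update B r ⟨e k, A k * (B r).2⟩)) : Protocol d B

/-- The identity operator at each party: the root of a complete protocol. -/
abbrev root {ι : Type*} (d : ι → ℕ) : ∀ r, LocalOp (d r) := fun r => ⟨d r, 1⟩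

namespace Protocol

variable {ι : Type*} [DecidableEq ι] {d : ι → ℕ}

/-- The leaves of a protocol tree, i.e. the possible courses of the protocol. -/
def Leaf : {B : ∀ r, LocalOp (d r)} → Protocol d B → Type
  | _, halt _ => Unit
  | _, step _ _ m _ _ _ next => Σ k : Fin m, (next k).Leaf

/-- A protocol tree has finitely many leaves. -/
instance leafFintype : {B : ∀ r, LocalOp (d r)} → (P : Protocol d B) → Fintype P.Leaf
  | _, halt _ => inferInstanceAs (Fintype Unit)
  | _, step _ _ m _ _ _ next =>
    haveI := fun k => leafFintype (next k)
    inferInstanceAs (Fintype (Σ k : Fin m, (next k).Leaf))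

/-- The local factors of the operator accumulated along the path from the root to a leaf. -/
def leafOp : {B : ∀ r, LocalOp (d r)} → (P : Protocol d B) → P.Leaf → ∀ r, LocalOp (d r)
  | B, halt _, _ => B
  | _, step _ _ _ _ _ _ next, l => (next l.1).leafOp l.2

/-- The effect `Aᴴ * A` of a leaf, `A` being the product operator accumulated along the path. -/
def leafEffect [Fintype ι] {B : ∀ r, LocalOp (d r)} (P : Protocol d B) (l : P.Leaf) :
    Matrix (Idx d) (Idx d) ℂ :=
  (tensorOp fun r => (P.leafOp l r).2)ᴴ * tensorOp fun r => (P.leafOp l r).2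

end Protocol

/-- The family of effects `E` is a finite LOCC measurement: it is implemented by a finite
protocol tree followed by a classical post-processing `π` of the course of the protocol. -/
def IsFiniteLOCC {ι : Type*} [Fintype ι] [DecidableEq ι] {d : ι → ℕ} {n : ℕ}
    (E : Fin n → Matrix (Idx d) (Idx d) ℂ) : Prop :=
  ∃ (P : Protocol d (root d)) (π : P.Leaf → Fin n → ℝ),
    (∀ l k, 0 ≤ π l k) ∧ (∀ l, ∑ k, π l k = 1) ∧
    ∀ k, E k = ∑ l, (π l k : ℂ) • P.leafEffect l

/-- The minimal mean failure probability
`1 - ∑ k, max μ (p μ * tr (ρ μ * E k))` of the measurement `E` for the a priori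
probabilities `p`. -/
def meanFailure {κ : Type*} [Fintype κ] {N n : ℕ} (p : Fin N → ℝ)
    (ρ : Fin N → Matrix κ κ ℂ) (E : Fin n → Matrix κ κ ℂ) : ℝ :=
  1 - ∑ k, ⨆ μ, p μ * (ρ μ * E k).trace.re

/-- The infimum of the mean failure probability over all finite LOCC measurements. -/
def asymptoticMeanFailure {ι : Type*} [Fintype ι] [DecidableEq ι] {d : ι → ℕ} {N : ℕ}
    (p : Fin N → ℝ) (ρ : Fin N → Matrix (Idx d) (Idx d) ℂ) : ℝ :=
  sInf {x : ℝ | ∃ (n : ℕ) (E : Fin n → Matrix (Idx d) (Idx d) ℂ),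
    IsFiniteLOCC E ∧ x = meanFailure p ρ E}

end

end AsymptoticLOCC

/-! Give a positive operator `X` the weights tr(`X * ρ μ`), with sum T(`X`), and call it balanced if
no weight exceeds `χ` T(`X`). The root effect 1 is balanced because `1 / N ≤ χ`, but guessing at a
balanced leaf costs an error of at least (1 - `χ`) T. For `χ < 1` a protocol with small error must
therefore leave the balanced region. A measurement step changes the factor of one party only, so the
segments joining sums of children consist of product effects, and some of them cross the boundary of
the region.

The quantitative form is `lower_bound_add` and `Protocol.lower_bound`: if every product effect on
the boundary had error at least `δ` T, with `δ ≤ 1 - χ`, so would every balanced node, in particular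
the root. Perfect asymptotic discrimination thus yields boundary product effects of arbitrarily
small relative error (`exists_boundary_effect`).

For the limit, `Discriminable` forgets the protocol and keeps one operator `M ν` per guess, so the
number of operators does not grow with the tree. With local factors of trace 1 everything lies in a
compact set, and a limit point has error 0. Then `M ν * ρ μ = 0` for `μ ≠ ν`, which makes the states
orthogonal after the effect `∑ ν, M ν` (`mul_sum_mul_eq_zero`). The kernel condition keeps T
positive in the limit (`totalWeight_pos`), so the effect can be divided by T. -/

namespace AsymptoticLOCC

noncomputable section

/-! ### Weights of effects, discrimination errors and the boundary of the balanced region -/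

section Weight

variable {κ : Type*} [Fintype κ]

open scoped MatrixOrder in
lemma trace_mul_nonneg_of_posSemidef {A B : Matrix κ κ ℂ} (hA : A.PosSemidef)
    (hB : B.PosSemidef) : 0 ≤ (A * B).trace := by
  classical
  obtain ⟨X, rfl⟩ := CStarAlgebra.nonneg_iff_eq_star_mul_self.mp
    (Matrix.nonneg_iff_posSemidef.mpr hB)
  rw [Matrix.star_eq_conjTranspose, ← Matrix.mul_assoc, Matrix.trace_mul_comm, ← Matrix.mul_assoc]
  exact (hA.mul_mul_conjTranspose_same X).trace_nonneg

-- With `A = Xᴴ * X` and `B = Yᴴ * Y`, the trace is the squared Hilbert–Schmidt norm of `X * Yᴴ`, a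
-- factor of `A * B`.
open scoped MatrixOrder in
lemma mul_eq_zero_of_trace_mul_eq_zero {A B : Matrix κ κ ℂ} (hA : A.PosSemidef)
    (hB : B.PosSemidef) (h : (A * B).trace = 0) : A * B = 0 := by
  classical
  obtain ⟨X, rfl⟩ := CStarAlgebra.nonneg_iff_eq_star_mul_self.mp
    (Matrix.nonneg_iff_posSemidef.mpr hA)
  obtain ⟨Y, rfl⟩ := CStarAlgebra.nonneg_iff_eq_star_mul_self.mp
    (Matrix.nonneg_iff_posSemidef.mpr hB)
  simp only [Matrix.star_eq_conjTranspose] at h ⊢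
  have h0 : X * Yᴴ = 0 := by
    rw [← Matrix.trace_conjTranspose_mul_self_eq_zero_iff, ← h, Matrix.conjTranspose_mul,
      Matrix.conjTranspose_conjTranspose, Matrix.mul_assoc, Matrix.trace_mul_comm]
    simp only [Matrix.mul_assoc]
  rw [Matrix.mul_assoc, ← Matrix.mul_assoc X, h0]
  simp

/-- The linear functional `X ↦ tr (X * ρ)`, real part. -/
def weight (ρ : Matrix κ κ ℂ) : Matrix κ κ ℂ →ₗ[ℝ] ℝ where
  toFun X := (X * ρ).trace.re
  map_add' X Y := by simp [Matrix.add_mul]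
  map_smul' c X := by simp

lemma weight_apply (ρ X : Matrix κ κ ℂ) : weight ρ X = (X * ρ).trace.re := rfl

lemma weight_nonneg {ρ X : Matrix κ κ ℂ} (hρ : ρ.PosSemidef) (hX : X.PosSemidef) :
    0 ≤ weight ρ X :=
  (Complex.nonneg_iff.mp (trace_mul_nonneg_of_posSemidef hX hρ)).1

lemma trace_mul_eq_weight {ρ X : Matrix κ κ ℂ} (hρ : ρ.PosSemidef) (hX : X.PosSemidef) :
    (X * ρ).trace = (weight ρ X : ℂ) :=
  Complex.ext rfl (Complex.nonneg_iff.mp (trace_mul_nonneg_of_posSemidef hX hρ)).2.symm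

lemma mul_eq_zero_of_weight_eq_zero {ρ X : Matrix κ κ ℂ} (hρ : ρ.PosSemidef)
    (hX : X.PosSemidef) (h : weight ρ X = 0) : X * ρ = 0 :=
  mul_eq_zero_of_trace_mul_eq_zero hX hρ (by rw [trace_mul_eq_weight hρ hX, h, Complex.ofReal_zero])

lemma continuous_weight (ρ : Matrix κ κ ℂ) : Continuous (weight ρ) := by
  change Continuous fun X : Matrix κ κ ℂ => (X * ρ).trace.re
  fun_prop

variable {N : ℕ}

/-- The sum of the weights of all states. -/
def totalWeight (ρ : Fin N → Matrix κ κ ℂ) : Matrix κ κ ℂ →ₗ[ℝ] ℝ := ∑ μ, weight (ρ μ)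

lemma totalWeight_apply (ρ : Fin N → Matrix κ κ ℂ) (X : Matrix κ κ ℂ) :
    totalWeight ρ X = ∑ μ, weight (ρ μ) X := by
  simp [totalWeight]

lemma continuous_totalWeight (ρ : Fin N → Matrix κ κ ℂ) : Continuous (totalWeight ρ) := by
  simp only [funext (totalWeight_apply ρ)]
  exact continuous_finsetSum _ fun μ _ => continuous_weight (ρ μ)

lemma totalWeight_nonneg {ρ : Fin N → Matrix κ κ ℂ}
    (hρ : ∀ μ, (ρ μ).PosSemidef) {X : Matrix κ κ ℂ}
    (hX : X.PosSemidef) : 0 ≤ totalWeight ρ X := by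
  rw [totalWeight_apply]
  exact Finset.sum_nonneg fun μ _ => weight_nonneg (hρ μ) hX

lemma weight_le_totalWeight {ρ : Fin N → Matrix κ κ ℂ}
    (hρ : ∀ μ, (ρ μ).PosSemidef) {X : Matrix κ κ ℂ}
    (hX : X.PosSemidef) (μ : Fin N) : weight (ρ μ) X ≤ totalWeight ρ X := by
  rw [totalWeight_apply]
  exact Finset.single_le_sum (f := fun μ => weight (ρ μ) X) (fun μ _ => weight_nonneg (hρ μ) hX)
    (Finset.mem_univ μ)

lemma totalWeight_one [DecidableEq κ] {ρ : Fin N → Matrix κ κ ℂ} (hρ : ∀ μ, IsState (ρ μ)) :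
    totalWeight ρ 1 = N := by
  simp [totalWeight_apply, weight_apply, (hρ _).2]

/-- The total weight of the states that are not the most likely one. -/
def guessError (ρ : Fin N → Matrix κ κ ℂ) (X : Matrix κ κ ℂ) : ℝ :=
  totalWeight ρ X - ⨆ μ, weight (ρ μ) X

lemma weight_le_iSup (ρ : Fin N → Matrix κ κ ℂ) (X : Matrix κ κ ℂ) (ν : Fin N) :
    weight (ρ ν) X ≤ ⨆ μ, weight (ρ μ) X :=
  le_ciSup (f := fun μ => weight (ρ μ) X) (Set.finite_range _).bddAbove ν

/-- `X` is a sum of effects `M ν`, such that guessing `ν` upon `M ν` has a total weight of errors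
of at most `h`. -/
def Discriminable (ρ : Fin N → Matrix κ κ ℂ) (X : Matrix κ κ ℂ) (h : ℝ) : Prop :=
  ∃ M : Fin N → Matrix κ κ ℂ, (∀ ν, (M ν).PosSemidef) ∧ ∑ ν, M ν = X ∧
    ∑ ν, (totalWeight ρ (M ν) - weight (ρ ν) (M ν)) ≤ h

namespace Discriminable

variable {ρ : Fin N → Matrix κ κ ℂ} {X Y : Matrix κ κ ℂ} {a b : ℝ}

lemma zero : Discriminable ρ 0 0 :=
  ⟨0, fun _ => .zero, by simp, by simp⟩

lemma add (hX : Discriminable ρ X a) (hY : Discriminable ρ Y b) :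
    Discriminable ρ (X + Y) (a + b) := by
  obtain ⟨M, hM, rfl, hMa⟩ := hX
  obtain ⟨L, hL, rfl, hLb⟩ := hY
  refine ⟨M + L, fun ν => (hM ν).add (hL ν), by simp [Finset.sum_add_distrib], ?_⟩
  refine le_trans (le_of_eq ?_) (add_le_add hMa hLb)
  rw [← Finset.sum_add_distrib]
  exact Finset.sum_congr rfl fun ν _ => by simp only [Pi.add_apply, map_add]; ring

lemma smul {s : ℝ} (hs : 0 ≤ s) (hX : Discriminable ρ X a) : Discriminable ρ (s • X) (s * a) := by
  obtain ⟨M, hM, rfl, hMa⟩ := hX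
  refine ⟨s • M, fun ν => (hM ν).smul hs, by simp [Finset.smul_sum], ?_⟩
  refine le_trans (le_of_eq ?_) (mul_le_mul_of_nonneg_left hMa hs)
  rw [Finset.mul_sum]
  exact Finset.sum_congr rfl fun ν _ => by
    simp only [Pi.smul_apply, map_smul, smul_eq_mul]; ring

lemma sum {α : Type*} (s : Finset α) {X : α → Matrix κ κ ℂ} {a : α → ℝ}
    (h : ∀ k ∈ s, Discriminable ρ (X k) (a k)) :
    Discriminable ρ (∑ k ∈ s, X k) (∑ k ∈ s, a k) := by
  classical
  induction s using Finset.induction_on with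
  | empty => simpa using zero
  | insert k s hk ih =>
    rw [Finset.sum_insert hk, Finset.sum_insert hk]
    exact (h k (by simp)).add (ih fun j hj => h j (by simp [hj]))

lemma guessError [NeZero N] (hX : X.PosSemidef) : Discriminable ρ X (guessError ρ X) := by
  obtain ⟨ν, hν⟩ := exists_eq_ciSup_of_finite (f := fun μ => weight (ρ μ) X)
  refine ⟨Pi.single ν X, fun μ => ?_, by simp, ?_⟩
  · by_cases h : μ = ν
    · subst h; simpa using hX
    · simpa [h] using Matrix.PosSemidef.zero
  · rw [Finset.sum_eq_single ν (fun μ _ h => by simp [h]) (by simp)]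
    simp only [Pi.single_eq_same, AsymptoticLOCC.guessError, ← hν, le_refl]

end Discriminable

/-- If `X + Y` is balanced (no state has a relative weight exceeding `χ`) but `X` is not,
then some point of the segment from `X` to `X + Y` lies on the boundary. -/
lemma exists_crossing [NeZero N] (ρ : Fin N → Matrix κ κ ℂ) {χ : ℝ} {X Y : Matrix κ κ ℂ}
    (hX : ∃ μ, χ * totalWeight ρ X < weight (ρ μ) X)
    (hXY : ∀ μ, weight (ρ μ) (X + Y) ≤ χ * totalWeight ρ (X + Y)) :
    ∃ s ∈ Set.Icc (0 : ℝ) 1,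
      (∀ μ, weight (ρ μ) (X + s • Y) ≤ χ * totalWeight ρ (X + s • Y)) ∧
      ∃ μ, weight (ρ μ) (X + s • Y) = χ * totalWeight ρ (X + s • Y) := by
  let φ : ℝ → ℝ := fun s => Finset.univ.sup' Finset.univ_nonempty fun μ =>
    weight (ρ μ) (X + s • Y) - χ * totalWeight ρ (X + s • Y)
  have hφ : Continuous φ := Continuous.finset_sup'_apply _ fun μ _ => by
    simp only [map_add, map_smul, smul_eq_mul]
    fun_prop
  have h0 : 0 ≤ φ 0 := by
    obtain ⟨μ, hμ⟩ := hX
    refine le_trans ?_ (Finset.le_sup' _ (Finset.mem_univ μ))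
    simpa using hμ.le
  have h1 : φ 1 ≤ 0 := Finset.sup'_le _ _ fun μ _ => by simpa using hXY μ
  obtain ⟨s, hs, hs0⟩ := intermediate_value_Icc' zero_le_one hφ.continuousOn ⟨h1, h0⟩
  refine ⟨s, hs, fun μ => ?_, ?_⟩
  · have := Finset.le_sup' (fun μ => weight (ρ μ) (X + s • Y) - χ * totalWeight ρ (X + s • Y))
      (Finset.mem_univ μ)
    change _ ≤ φ s at this
    linarith
  · obtain ⟨μ, -, hμ⟩ := Finset.exists_mem_eq_sup' (Finset.univ_nonempty (α := Fin N))
      fun μ => weight (ρ μ) (X + s • Y) - χ * totalWeight ρ (X + s • Y)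
    change φ s = _ at hμ
    exact ⟨μ, by linarith⟩

/-- Balanced sums inherit a lower bound on the error from the two summands, provided that it holds
at the boundary points of the segments between the summands and their sum. -/
lemma lower_bound_add [NeZero N] (ρ : Fin N → Matrix κ κ ℂ) {χ δ : ℝ} {S : Set (Matrix κ κ ℂ)}
    (hS : ∀ G ∈ S, ∀ h, (∀ μ, weight (ρ μ) G ≤ χ * totalWeight ρ G) →
      (∃ μ, weight (ρ μ) G = χ * totalWeight ρ G) → Discriminable ρ G h → δ * totalWeight ρ G ≤ h)
    {X Y : Matrix κ κ ℂ} (hXS : ∀ s : ℝ, 0 ≤ s → X + s • Y ∈ S)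
    (hYS : ∀ s : ℝ, 0 ≤ s → Y + s • X ∈ S) {a b : ℝ}
    (hXa : Discriminable ρ X a) (hYb : Discriminable ρ Y b)
    (hX : (∀ μ, weight (ρ μ) X ≤ χ * totalWeight ρ X) → δ * totalWeight ρ X ≤ a)
    (hY : (∀ μ, weight (ρ μ) Y ≤ χ * totalWeight ρ Y) → δ * totalWeight ρ Y ≤ b)
    (hXY : ∀ μ, weight (ρ μ) (X + Y) ≤ χ * totalWeight ρ (X + Y)) :
    δ * totalWeight ρ (X + Y) ≤ a + b := by
  have key : ∀ {X Y : Matrix κ κ ℂ} {a b : ℝ}, (∀ s : ℝ, 0 ≤ s → X + s • Y ∈ S) →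
      Discriminable ρ X a → Discriminable ρ Y b →
      ((∀ μ, weight (ρ μ) X ≤ χ * totalWeight ρ X) → δ * totalWeight ρ X ≤ a) →
      (∀ μ, weight (ρ μ) (X + Y) ≤ χ * totalWeight ρ (X + Y)) →
      a < δ * totalWeight ρ X → δ * totalWeight ρ (X + Y) ≤ a + b := by
    intro X Y a b hXS hXa hYb hX hXY ha
    by_contra! hlt
    have hn : ∃ μ, χ * totalWeight ρ X < weight (ρ μ) X := by
      by_contra! h
      exact ha.not_ge (hX h)
    obtain ⟨s, ⟨hs0, hs1⟩, hle, heq⟩ := exists_crossing ρ hn hXY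
    -- The surplus a + t b - `δ` T(`X + t • Y`) is affine in t. It is negative at 0 and, by
    -- assumption, at 1, hence on all of [0, 1], contrary to the boundary bound at `s`.
    have := hS _ (hXS s hs0) _ hle heq (hXa.add (hYb.smul hs0))
    simp only [map_add, map_smul, smul_eq_mul] at this hlt
    rcases hs1.eq_or_lt with rfl | hs1
    · linarith
    · nlinarith [mul_pos (sub_pos.mpr hs1) (sub_pos.mpr ha), mul_nonneg hs0 (sub_pos.mpr hlt).le]
  rcases lt_or_ge a (δ * totalWeight ρ X) with ha | ha
  · exact key hXS hXa hYb hX hXY ha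
  rcases lt_or_ge b (δ * totalWeight ρ Y) with hb | hb
  · rw [add_comm X, add_comm a]
    exact key hYS hYb hXa hY (by simpa only [add_comm Y] using hXY) hb
  · rw [map_add]; linarith

end Weight

/-! ### Product effects and the error bound along a protocol tree -/

section Tensor

variable {ι : Type*} {d : ι → ℕ}

/-- The local effects of the operators that have been applied so far. -/
def localEffects (B : ∀ r, LocalOp (d r)) (r : ι) : Matrix (Fin (d r)) (Fin (d r)) ℂ :=
  (B r).2ᴴ * (B r).2

lemma posSemidef_localEffects (B : ∀ r, LocalOp (d r)) (r : ι) :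
    (localEffects B r).PosSemidef :=
  Matrix.posSemidef_conjTranspose_mul_self _

lemma localEffects_update [DecidableEq ι] (B : ∀ r, LocalOp (d r)) (r : ι) (x : LocalOp (d r)) :
    localEffects (Function.update B r x) = Function.update (localEffects B) r (x.2ᴴ * x.2) := by
  funext s
  exact Function.apply_update (fun r (y : LocalOp (d r)) => y.2ᴴ * y.2) B r x s

lemma Protocol.sum_leaf_step [DecidableEq ι] {α : Type*} [AddCommMonoid α] {B : ∀ r, LocalOp (d r)} {r : ι} {m : ℕ}
    {e : Fin m → ℕ} {A : ∀ k, Matrix (Fin (e k)) (Fin (B r).1) ℂ} {hA : ∑ k, (A k)ᴴ * A k = 1}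
    {next : ∀ k, Protocol d (Function.update B r ⟨e k, A k * (B r).2⟩)}
    (g : (Protocol.step B r m e A hA next).Leaf → α) : ∑ l, g l = ∑ k, ∑ l, g ⟨k, l⟩ :=
  Fintype.sum_sigma g

variable [Fintype ι]

lemma tensorOp_one :
    tensorOp (fun r => (1 : Matrix (Fin (d r)) (Fin (d r)) ℂ)) = 1 := by
  ext i j
  simp only [tensorOp, Matrix.of_apply, Matrix.one_apply, funext_iff]
  by_cases h : ∀ r, i r = j r
  · simp [h]
  · push Not at h
    obtain ⟨r, hr⟩ := h
    rw [if_neg fun h => hr (h r), Finset.prod_eq_zero (Finset.mem_univ r) (if_neg hr)]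

lemma continuous_tensorOp :
    Continuous (tensorOp : (∀ r, Matrix (Fin (d r)) (Fin (d r)) ℂ) → Matrix (Idx d) (Idx d) ℂ) := by
  refine continuous_matrix fun i j => ?_
  simp only [tensorOp, Matrix.of_apply]
  fun_prop

lemma tensorOp_localEffects_root : tensorOp (localEffects (root d)) = 1 := by
  rw [← tensorOp_one]
  congr 1
  funext r
  simp [localEffects]

lemma tensorOp_smul (c : ι → ℝ) (F : ∀ r, Matrix (Fin (d r)) (Fin (d r)) ℂ) :
    tensorOp (fun r => c r • F r) = (∏ r, c r) • tensorOp F := by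
  ext i j
  simp [tensorOp, Finset.prod_mul_distrib]

variable [DecidableEq ι]

lemma tensorOp_conjTranspose_mul_self {e : ι → ℕ}
    (F : ∀ r, Matrix (Fin (e r)) (Fin (d r)) ℂ) :
    (tensorOp F)ᴴ * tensorOp F = tensorOp fun r => (F r)ᴴ * F r := by
  ext i j
  simp only [tensorOp, Matrix.mul_apply, Matrix.conjTranspose_apply, Matrix.of_apply, star_prod,
    ← Finset.prod_mul_distrib, Fintype.prod_sum]

lemma trace_tensorOp (F : ∀ r, Matrix (Fin (d r)) (Fin (d r)) ℂ) :
    (tensorOp F).trace = ∏ r, (F r).trace := by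
  simp only [tensorOp, Matrix.trace, Matrix.diag_apply, Matrix.of_apply, Fintype.prod_sum]

open scoped MatrixOrder in
lemma posSemidef_tensorOp {F : ∀ r, Matrix (Fin (d r)) (Fin (d r)) ℂ}
    (hF : ∀ r, (F r).PosSemidef) : (tensorOp F).PosSemidef := by
  have h (r) : ∃ X : Matrix (Fin (d r)) (Fin (d r)) ℂ, F r = Xᴴ * X :=
    CStarAlgebra.nonneg_iff_eq_star_mul_self.mp (Matrix.nonneg_iff_posSemidef.mpr (hF r))
  choose X hX using h
  obtain rfl : F = fun r => (X r)ᴴ * X r := funext hX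
  rw [← tensorOp_conjTranspose_mul_self]
  exact Matrix.posSemidef_conjTranspose_mul_self _

/-- The tensor product as a linear function of the factor `r`. -/
def tensorOpAt (C : ∀ r, Matrix (Fin (d r)) (Fin (d r)) ℂ) (r : ι) :
    Matrix (Fin (d r)) (Fin (d r)) ℂ →ₗ[ℝ] Matrix (Idx d) (Idx d) ℂ where
  toFun X := tensorOp (Function.update C r X)
  map_add' X Y := by
    ext i j
    simp only [tensorOp, Matrix.of_apply, Matrix.add_apply]
    refine (Finset.prod_add_prod_eq (Finset.mem_univ r) ?_ ?_ ?_).symm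
    · simp
    · intro s _ hs; simp [hs]
    · intro s _ hs; simp [hs]
  map_smul' c X := by
    ext i j
    simp only [tensorOp, Matrix.of_apply, Matrix.smul_apply, RingHom.id_apply]
    rw [← Finset.mul_prod_erase _ _ (Finset.mem_univ r),
      ← Finset.mul_prod_erase _ _ (Finset.mem_univ r)]
    simp only [Function.update_self, Matrix.smul_apply, smul_mul_assoc]
    congr 2
    exact Finset.prod_congr rfl fun s hs => by simp [Finset.ne_of_mem_erase hs]

lemma tensorOpAt_apply (C : ∀ r, Matrix (Fin (d r)) (Fin (d r)) ℂ) (r : ι)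
    (X : Matrix (Fin (d r)) (Fin (d r)) ℂ) :
    tensorOpAt C r X = tensorOp (Function.update C r X) := rfl

/-- The tensor products of positive semidefinite operators. -/
def productEffects (d : ι → ℕ) : Set (Matrix (Idx d) (Idx d) ℂ) :=
  {G | ∃ F : ∀ r, Matrix (Fin (d r)) (Fin (d r)) ℂ, (∀ r, (F r).PosSemidef) ∧ G = tensorOp F}

lemma tensorOpAt_mem {C : ∀ r, Matrix (Fin (d r)) (Fin (d r)) ℂ} (hC : ∀ r, (C r).PosSemidef)
    {r : ι} {X : Matrix (Fin (d r)) (Fin (d r)) ℂ} (hX : X.PosSemidef) :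
    tensorOpAt C r X ∈ productEffects d := by
  refine ⟨Function.update C r X, fun s => ?_, rfl⟩
  by_cases h : s = r
  · subst h; simpa using hX
  · simpa [h] using hC s

/-- A local measurement decomposes the effect of a node into the effects of its children. -/
lemma tensorOp_localEffects_eq_sum (B : ∀ r, LocalOp (d r)) (r : ι) {m : ℕ} {e : Fin m → ℕ}
    (A : ∀ k, Matrix (Fin (e k)) (Fin (B r).1) ℂ) (hA : ∑ k, (A k)ᴴ * A k = 1) :
    tensorOp (localEffects B) =
      ∑ k, tensorOpAt (localEffects B) r ((A k * (B r).2)ᴴ * (A k * (B r).2)) := by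
  have h : ∑ k, (A k * (B r).2)ᴴ * (A k * (B r).2) = localEffects B r := by
    calc ∑ k, (A k * (B r).2)ᴴ * (A k * (B r).2)
        = ∑ k, (B r).2ᴴ * ((A k)ᴴ * A k) * (B r).2 :=
          Finset.sum_congr rfl fun k _ => by simp only [Matrix.conjTranspose_mul, Matrix.mul_assoc]
      _ = localEffects B r := by
          rw [← Matrix.sum_mul, ← Matrix.mul_sum, hA, Matrix.mul_one, localEffects]
  rw [← map_sum, h, tensorOpAt_apply, Function.update_eq_self]

namespace Protocol

lemma sum_leaf_halt {α : Type*} [AddCommMonoid α] (B : ∀ r, LocalOp (d r))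
    (g : Matrix (Idx d) (Idx d) ℂ → α) :
    ∑ l, g ((halt B).leafEffect l) = g (tensorOp (localEffects B)) :=
  (Fintype.sum_unique (ι := Unit) fun _ => g ((tensorOp fun r => (B r).2)ᴴ *
    tensorOp fun r => (B r).2)).trans (congrArg g (tensorOp_conjTranspose_mul_self _))

/-- The effects of the leaves sum up to the effect of the node. -/
lemma sum_leafEffect {B : ∀ r, LocalOp (d r)} (P : Protocol d B) :
    ∑ l, P.leafEffect l = tensorOp (localEffects B) := by
  induction P with
  | halt B => exact sum_leaf_halt B id
  | step B r m e A hA next ih =>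
    rw [sum_leaf_step, tensorOp_localEffects_eq_sum B r A hA]
    refine Finset.sum_congr rfl fun k _ => (ih k).trans ?_
    rw [localEffects_update, tensorOpAt_apply]

lemma posSemidef_leafEffect {B : ∀ r, LocalOp (d r)} (P : Protocol d B) (l : P.Leaf) :
    (P.leafEffect l).PosSemidef :=
  Matrix.posSemidef_conjTranspose_mul_self _

variable {N : ℕ} [NeZero N] (ρ : Fin N → Matrix (Idx d) (Idx d) ℂ)

/-- Leaves with the same best guess are merged into one operator; the locality of the measurement is
forgotten. -/
lemma discriminable {B : ∀ r, LocalOp (d r)} (P : Protocol d B) :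
    Discriminable ρ (tensorOp (localEffects B)) (∑ l, guessError ρ (P.leafEffect l)) := by
  rw [← P.sum_leafEffect]
  exact .sum _ fun l _ => .guessError (P.posSemidef_leafEffect l)

/-- If all boundary effects are discriminated badly, so are the balanced effects of the nodes. -/
lemma lower_bound {χ δ : ℝ} (hδ : δ ≤ 1 - χ) (hρ : ∀ μ, (ρ μ).PosSemidef)
    (hS : ∀ G ∈ productEffects d, ∀ h, (∀ μ, weight (ρ μ) G ≤ χ * totalWeight ρ G) →
      (∃ μ, weight (ρ μ) G = χ * totalWeight ρ G) → Discriminable ρ G h → δ * totalWeight ρ G ≤ h)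
    {B : ∀ r, LocalOp (d r)} (P : Protocol d B)
    (hB : ∀ μ, weight (ρ μ) (tensorOp (localEffects B)) ≤
      χ * totalWeight ρ (tensorOp (localEffects B))) :
    δ * totalWeight ρ (tensorOp (localEffects B)) ≤ ∑ l, guessError ρ (P.leafEffect l) := by
  induction P with
  | halt B =>
    rw [sum_leaf_halt B (guessError ρ)]
    have hT : 0 ≤ totalWeight ρ (tensorOp (localEffects B)) :=
      totalWeight_nonneg hρ (posSemidef_tensorOp (posSemidef_localEffects B))
    -- At a balanced leaf even the best guess has weight at most `χ` T, so the error is at least (1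
    -- - `χ`) T.
    have := ciSup_le hB
    rw [guessError]
    nlinarith [mul_le_mul_of_nonneg_right hδ hT]
  | step B r m e A hA next ih =>
    let X : Fin m → Matrix (Fin (d r)) (Fin (d r)) ℂ := fun k =>
      (A k * (B r).2)ᴴ * (A k * (B r).2)
    have hX (k) : (X k).PosSemidef := Matrix.posSemidef_conjTranspose_mul_self _
    let L := tensorOpAt (localEffects B) r
    have hL {Y} (hY : Y.PosSemidef) : L Y ∈ productEffects d :=
      tensorOpAt_mem (posSemidef_localEffects B) hY
    have hchild (k) : tensorOp (localEffects (Function.update B r ⟨e k, A k * (B r).2⟩)) =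
        L (X k) := by
      rw [localEffects_update]; rfl
    let g : Fin m → ℝ := fun k => ∑ l, guessError ρ ((next k).leafEffect l)
    have hD (k) : Discriminable ρ (L (X k)) (g k) := by
      rw [← hchild]; exact (next k).discriminable ρ
    have ih' (k) (h : ∀ μ, weight (ρ μ) (L (X k)) ≤ χ * totalWeight ρ (L (X k))) :
        δ * totalWeight ρ (L (X k)) ≤ g k := by
      have := ih k
      rw [hchild] at this
      exact this h
    -- The children are merged one at a time. Partial sums need not be balanced, so the claim is
    -- conditional on balance. Only the factor `r` varies, hence by linearity of `L` all segments
    -- stay among product effects.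
    have key : ∀ s : Finset (Fin m),
        (∀ μ, weight (ρ μ) (∑ k ∈ s, L (X k)) ≤ χ * totalWeight ρ (∑ k ∈ s, L (X k))) →
        δ * totalWeight ρ (∑ k ∈ s, L (X k)) ≤ ∑ k ∈ s, g k := by
      intro s
      induction s using Finset.induction_on with
      | empty => simp
      | insert k s hk ihs =>
        rw [Finset.sum_insert hk, Finset.sum_insert hk]
        have hs : (∑ k ∈ s, X k).PosSemidef := Matrix.posSemidef_sum _ fun k _ => hX k
        refine lower_bound_add ρ hS (fun t ht => ?_) (fun t ht => ?_) (hD k)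
          (.sum s fun k _ => hD k) (ih' k) ihs
        · rw [← map_sum, ← map_smul, ← map_add]
          exact hL ((hX k).add (hs.smul ht))
        · rw [← map_sum, ← map_smul, ← map_add]
          exact hL (hs.add ((hX k).smul ht))
    rw [tensorOp_localEffects_eq_sum B r A hA] at hB ⊢
    rw [sum_leaf_step]
    exact key Finset.univ hB

end Protocol

end Tensor

open Filter Topology

/-! ### Compactness of bounded positive operators -/

section Compactness

variable {κ : Type*} [Fintype κ]

-- The set is the image of the closed Hilbert–Schmidt unit ball under `X ↦ Xᴴ * X`.
open scoped MatrixOrder in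
lemma isCompact_posSemidef_trace_le_one :
    IsCompact {A : Matrix κ κ ℂ | A.PosSemidef ∧ A.trace.re ≤ 1} := by
  have htr (X : Matrix κ κ ℂ) : (Xᴴ * X).trace.re = ∑ i, ∑ j, ‖X j i‖ ^ 2 := by
    simp [Matrix.trace, Matrix.mul_apply, ← Complex.normSq_apply, Complex.normSq_eq_norm_sq]
  have hK : IsCompact {X : Matrix κ κ ℂ | (Xᴴ * X).trace.re ≤ 1} := by
    have hball : IsCompact (Set.univ.pi fun _ : κ => Set.univ.pi fun _ : κ =>
        Metric.closedBall (0 : ℂ) 1) :=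
      isCompact_univ_pi fun _ => isCompact_univ_pi fun _ => isCompact_closedBall 0 1
    refine IsCompact.of_isClosed_subset hball
      (isClosed_le (f := fun X : Matrix κ κ ℂ => (Xᴴ * X).trace.re) (by fun_prop)
        continuous_const) fun X hX i _ j _ => ?_
    rw [Set.mem_ofPred_eq, htr] at hX
    rw [mem_closedBall_zero_iff, ← sq_le_one_iff₀ (norm_nonneg _)]
    refine le_trans ?_ hX
    refine le_trans ?_ (Finset.single_le_sum (f := fun j => ∑ i, ‖X i j‖ ^ 2)
      (fun j _ => Finset.sum_nonneg fun i _ => sq_nonneg _) (Finset.mem_univ j))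
    exact Finset.single_le_sum (f := fun i => ‖X i j‖ ^ 2) (fun i _ => sq_nonneg _)
      (Finset.mem_univ i)
  convert hK.image (f := fun X : Matrix κ κ ℂ => Xᴴ * X) (by fun_prop) using 1
  ext A
  constructor
  · rintro ⟨hA, hA1⟩
    classical
    obtain ⟨X, rfl⟩ := CStarAlgebra.nonneg_iff_eq_star_mul_self.mp
      (Matrix.nonneg_iff_posSemidef.mpr hA)
    exact ⟨X, hA1, rfl⟩
  · rintro ⟨X, hX, rfl⟩
    exact ⟨Matrix.posSemidef_conjTranspose_mul_self X, hX⟩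

end Compactness

/-! ### Consequences of the kernel condition and of zero error -/

variable {ι : Type*} [Fintype ι] [DecidableEq ι] {d : ι → ℕ} {N : ℕ}
  {ρ : Fin N → Matrix (Idx d) (Idx d) ℂ}

/-- The columns of a product operator are product vectors. So if no product vector is in the
kernel of all states, each normalised product effect is detected by some state. -/
lemma totalWeight_pos (hρ : ∀ μ, (ρ μ).PosSemidef)
    (hker : ∀ v : Idx d → ℂ, IsProductVector v → (∀ μ, (ρ μ).mulVec v = 0) → v = 0)
    {F : ∀ r, Matrix (Fin (d r)) (Fin (d r)) ℂ} (hF : ∀ r, (F r).PosSemidef)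
    (hF1 : ∀ r, (F r).trace = 1) : 0 < totalWeight ρ (tensorOp F) := by
  have hG := posSemidef_tensorOp hF
  refine (totalWeight_nonneg hρ hG).lt_of_ne fun h0 => ?_
  rw [totalWeight_apply, eq_comm, Finset.sum_eq_zero_iff_of_nonneg
    fun μ _ => weight_nonneg (hρ μ) hG] at h0
  have hmul (μ) : ρ μ * tensorOp F = 0 := by
    have := mul_eq_zero_of_weight_eq_zero (hρ μ) hG (h0 μ (Finset.mem_univ μ))
    have := congrArg Matrix.conjTranspose this
    rwa [Matrix.conjTranspose_mul, (hρ μ).isHermitian.eq, hG.isHermitian.eq,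
      Matrix.conjTranspose_zero] at this
  have hcol (j : Idx d) : (fun i => tensorOp F i j) = 0 := by
    refine hker _ ⟨fun r i => F r i (j r), rfl⟩ fun μ => ?_
    ext i
    exact congrFun (congrFun (hmul μ) i) j
  have htr : (tensorOp F).trace = 0 :=
    Finset.sum_eq_zero fun i _ => congrFun (hcol i) i
  rw [trace_tensorOp, Finset.prod_eq_one fun r _ => hF1 r] at htr
  exact one_ne_zero htr

/-- If the measurement `M` discriminates the states perfectly, the effect `∑ ν, M ν` leaves them
orthogonal. -/
lemma mul_sum_mul_eq_zero (hρ : ∀ μ, (ρ μ).PosSemidef) {M : Fin N → Matrix (Idx d) (Idx d) ℂ}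
    (hM : ∀ ν, (M ν).PosSemidef)
    (hsum : ∑ ν, (totalWeight ρ (M ν) - weight (ρ ν) (M ν)) ≤ 0) {μ ν : Fin N} (hμν : μ ≠ ν) :
    ρ μ * (∑ κ, M κ) * ρ ν = 0 := by
  have h0 := (Finset.sum_eq_zero_iff_of_nonneg fun κ _ =>
    sub_nonneg.mpr (weight_le_totalWeight hρ (hM κ) κ)).mp
    (hsum.antisymm (Finset.sum_nonneg fun κ _ =>
      sub_nonneg.mpr (weight_le_totalWeight hρ (hM κ) κ)))
  have hw {κ η : Fin N} (h : η ≠ κ) : M κ * ρ η = 0 := by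
    refine mul_eq_zero_of_weight_eq_zero (hρ η) (hM κ) ?_
    have := h0 κ (Finset.mem_univ κ)
    rw [totalWeight_apply, ← Finset.add_sum_erase _ _ (Finset.mem_univ κ), add_sub_cancel_left,
      Finset.sum_eq_zero_iff_of_nonneg fun η _ => weight_nonneg (hρ η) (hM κ)] at this
    exact this η (by simp [h])
  rw [Matrix.mul_sum, Matrix.sum_mul]
  refine Finset.sum_eq_zero fun κ _ => ?_
  -- Since `μ ≠ ν`, the index `κ` differs from at least one of them, and `M κ` annihilates that
  -- state.
  by_cases h : ν = κ
  · have := congrArg Matrix.conjTranspose (hw (h ▸ hμν : μ ≠ κ))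
    rw [Matrix.conjTranspose_mul, (hρ μ).isHermitian.eq, (hM κ).isHermitian.eq,
      Matrix.conjTranspose_zero] at this
    rw [this, Matrix.zero_mul]
  · rw [Matrix.mul_assoc, hw h, Matrix.mul_zero]

/-- The scalar is absorbed into one factor, so at least one party must exist. -/
lemma isProductOperator_smul [Nonempty ι] (c : ℝ) (F : ∀ r, Matrix (Fin (d r)) (Fin (d r)) ℂ) :
    IsProductOperator (c • tensorOp F) := by
  obtain ⟨r⟩ := ‹Nonempty ι›
  refine ⟨Function.update F r (c • F r), ?_⟩
  rw [← tensorOpAt_apply, map_smul, tensorOpAt_apply, Function.update_eq_self]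

/-! ### From small failure probability to a perfect boundary effect -/

variable [NeZero N]

/-- A perfect discrimination by asymptotic LOCC yields protocols with small errors of their
leaves. -/
lemma exists_protocol_sum_guessError_lt (hρ : ∀ μ, IsState (ρ μ)) {p : Fin N → ℝ}
    (hp : ∀ μ, 0 < p μ) (hp1 : ∑ μ, p μ = 1) (hd : asymptoticMeanFailure p ρ = 0)
    {ε : ℝ} (hε : 0 < ε) :
    ∃ P : Protocol d (root d), ∑ l, guessError ρ (P.leafEffect l) < ε := by
  -- The smallest prior converts errors weighted by `p` into unweighted ones; this is why the
  -- failure is pushed below `p ν * ε`.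
  obtain ⟨ν, hν⟩ := Finite.exists_min p
  have hne : {x : ℝ | ∃ (n : ℕ) (E : Fin n → Matrix (Idx d) (Idx d) ℂ),
      IsFiniteLOCC E ∧ x = meanFailure p ρ E}.Nonempty :=
    ⟨_, 1, fun _ => ∑ l, (1 : ℝ) • (Protocol.halt (root d)).leafEffect l,
      ⟨.halt (root d), fun _ _ => 1, by simp, by simp, fun _ => by simp⟩, rfl⟩
  obtain ⟨_, ⟨n, E, ⟨P, π, hπ, hπ1, hE⟩, rfl⟩, hlt⟩ :=
    exists_lt_of_csInf_lt hne (hd.trans_lt (mul_pos (hp ν) hε))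
  refine ⟨P, lt_of_mul_lt_mul_left (lt_of_le_of_lt ?_ hlt) (hp ν).le⟩
  have hE' (k) : E k = ∑ l, π l k • P.leafEffect l := by
    rw [hE]; exact Finset.sum_congr rfl fun l _ => Complex.coe_smul _ _
  have hEpos (k) : (E k).PosSemidef := by
    rw [hE']
    exact Matrix.posSemidef_sum _ fun l _ => (P.posSemidef_leafEffect l).smul (hπ l k)
  have hEsum : ∑ k, E k = 1 := by
    simp only [hE']
    rw [Finset.sum_comm]
    simp only [← Finset.sum_smul, hπ1, one_smul]
    rw [P.sum_leafEffect, tensorOp_localEffects_root]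
  have htot : ∑ k, ∑ μ, p μ * weight (ρ μ) (E k) = 1 := by
    rw [Finset.sum_comm]
    rw [← hp1]
    refine Finset.sum_congr rfl fun μ _ => ?_
    rw [← Finset.mul_sum, ← map_sum, hEsum, weight_apply, Matrix.one_mul, (hρ μ).2,
      Complex.one_re, mul_one]
  have hmean : meanFailure p ρ E =
      ∑ k, (∑ μ, p μ * weight (ρ μ) (E k) - ⨆ μ, p μ * weight (ρ μ) (E k)) := by
    rw [Finset.sum_sub_distrib, htot, meanFailure]
    simp only [weight_apply, Matrix.trace_mul_comm (ρ _)]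
  have hterm (k) : ∑ l, p ν * (π l k * guessError ρ (P.leafEffect l)) ≤
      ∑ μ, p μ * weight (ρ μ) (E k) - ⨆ μ, p μ * weight (ρ μ) (E k) := by
    -- Post-processing cannot help: the best guess `m` for the outcome `k` is at no leaf better than
    -- that leaf's own best guess.
    obtain ⟨m, hm⟩ := exists_eq_ciSup_of_finite (f := fun μ => p μ * weight (ρ μ) (E k))
    calc ∑ l, p ν * (π l k * guessError ρ (P.leafEffect l))
        ≤ ∑ l, p ν * (π l k *
            (totalWeight ρ (P.leafEffect l) - weight (ρ m) (P.leafEffect l))) := by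
          refine Finset.sum_le_sum fun l _ => ?_
          refine mul_le_mul_of_nonneg_left (mul_le_mul_of_nonneg_left ?_ (hπ l k)) (hp ν).le
          exact sub_le_sub_left (weight_le_iSup ρ _ m) _
      _ = p ν * (totalWeight ρ (E k) - weight (ρ m) (E k)) := by
          rw [hE']
          simp only [map_sum, map_smul, smul_eq_mul, mul_sub, Finset.sum_sub_distrib,
            Finset.mul_sum]
      _ = ∑ μ ∈ Finset.univ.erase m, p ν * weight (ρ μ) (E k) := by
          rw [totalWeight_apply, ← Finset.add_sum_erase _ _ (Finset.mem_univ m),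
            add_sub_cancel_left, Finset.mul_sum]
      _ ≤ ∑ μ ∈ Finset.univ.erase m, p μ * weight (ρ μ) (E k) :=
          Finset.sum_le_sum fun μ _ =>
            mul_le_mul_of_nonneg_right (hν μ) (weight_nonneg (hρ μ).1 (hEpos k))
      _ = _ := by
          rw [← hm, ← Finset.add_sum_erase _ _ (Finset.mem_univ m), add_sub_cancel_left]
  calc p ν * ∑ l, guessError ρ (P.leafEffect l)
      = ∑ k, ∑ l, p ν * (π l k * guessError ρ (P.leafEffect l)) := by
        rw [Finset.sum_comm]
        simp only [← Finset.mul_sum, ← Finset.sum_mul, hπ1, one_mul]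
    _ ≤ meanFailure p ρ E := hmean ▸ Finset.sum_le_sum fun k _ => hterm k

/-- There are boundary effects that are discriminated well. -/
lemma exists_boundary_effect (hρ : ∀ μ, IsState (ρ μ))
    (hsmall : ∀ ε > 0, ∃ P : Protocol d (root d), ∑ l, guessError ρ (P.leafEffect l) < ε)
    {χ δ : ℝ} (hχ0 : 1 / (N : ℝ) ≤ χ) (hχ1 : χ < 1) (hδ : 0 < δ) :
    ∃ G ∈ productEffects d, ∃ h, (∀ μ, weight (ρ μ) G ≤ χ * totalWeight ρ G) ∧
      (∃ μ, weight (ρ μ) G = χ * totalWeight ρ G) ∧ Discriminable ρ G h ∧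
      h < δ * totalWeight ρ G := by
  by_contra! hcon
  have hN : (0 : ℝ) < N := Nat.cast_pos.mpr (NeZero.pos N)
  -- The bound at the leaves needs a constant of at most `1 - χ`. The factor `N` below is the total
  -- weight of the root effect.
  have hδ' : 0 < min δ (1 - χ) := lt_min hδ (sub_pos.mpr hχ1)
  obtain ⟨P, hP⟩ := hsmall _ (mul_pos hδ' hN)
  refine hP.not_ge ?_
  have := P.lower_bound ρ (min_le_right δ (1 - χ)) (fun μ => (hρ μ).1) (fun G hG h h1 h2 h3 => ?_)
    (fun μ => ?_)
  · rwa [tensorOp_localEffects_root, totalWeight_one hρ] at this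
  · obtain ⟨F, hF, rfl⟩ := hG
    exact (mul_le_mul_of_nonneg_right (min_le_left _ _) (totalWeight_nonneg (fun μ => (hρ μ).1)
      (posSemidef_tensorOp hF))).trans (hcon _ ⟨F, hF, rfl⟩ h h1 h2 h3)
  · rw [tensorOp_localEffects_root, totalWeight_one hρ, weight_apply, Matrix.one_mul, (hρ μ).2,
      Complex.one_re]
    rwa [div_le_iff₀ hN] at hχ0

/-- The local factors can be normalised. -/
lemma exists_normalised_boundary_effect (hρ : ∀ μ, IsState (ρ μ))
    (hsmall : ∀ ε > 0, ∃ P : Protocol d (root d), ∑ l, guessError ρ (P.leafEffect l) < ε)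
    {χ δ : ℝ} (hχ0 : 1 / (N : ℝ) ≤ χ) (hχ1 : χ < 1) (hδ : 0 < δ) :
    ∃ (F : ∀ r, Matrix (Fin (d r)) (Fin (d r)) ℂ) (M : Fin N → Matrix (Idx d) (Idx d) ℂ),
      (∀ r, (F r).PosSemidef) ∧ (∀ r, (F r).trace = 1) ∧ (∀ ν, (M ν).PosSemidef) ∧
      ∑ ν, M ν = tensorOp F ∧
      (∀ μ, weight (ρ μ) (tensorOp F) ≤ χ * totalWeight ρ (tensorOp F)) ∧
      ∏ μ, (weight (ρ μ) (tensorOp F) - χ * totalWeight ρ (tensorOp F)) = 0 ∧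
      ∑ ν, (totalWeight ρ (M ν) - weight (ρ ν) (M ν)) ≤ δ * totalWeight ρ (tensorOp F) := by
  obtain ⟨_, ⟨F, hF, rfl⟩, h, hle, ⟨m, hm⟩, hD, hlt⟩ :=
    exists_boundary_effect hρ hsmall hχ0 hχ1 hδ
  -- Errors are nonnegative, so the strict bound `h < δ * T` already forces T > 0; hence no local
  -- factor vanishes.
  have hT : 0 < totalWeight ρ (tensorOp F) := by
    obtain ⟨M, hM, -, hMh⟩ := hD
    have : 0 ≤ ∑ ν, (totalWeight ρ (M ν) - weight (ρ ν) (M ν)) := Finset.sum_nonneg fun ν _ =>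
      sub_nonneg.mpr (weight_le_totalWeight (fun μ => (hρ μ).1) (hM ν) ν)
    exact pos_of_mul_pos_right (this.trans_lt (hMh.trans_lt hlt)) hδ.le
  have hFtr (r) : (F r).trace = ((F r).trace.re : ℂ) :=
    Complex.ext rfl (Complex.nonneg_iff.mp (hF r).trace_nonneg).2.symm
  have hF0 (r) : 0 < (F r).trace.re := by
    refine (Complex.nonneg_iff.mp (hF r).trace_nonneg).1.lt_of_ne fun h0 => hT.ne' ?_
    have hFr : F r = 0 := by
      rw [← (hF r).trace_eq_zero_iff, hFtr, ← h0, Complex.ofReal_zero]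
    have : tensorOp F = 0 := by
      ext i j
      exact Finset.prod_eq_zero (Finset.mem_univ r) (by simp [hFr])
    rw [this, map_zero]
  let c : ι → ℝ := fun r => (F r).trace.re⁻¹
  have hc : 0 < ∏ r, c r := Finset.prod_pos fun r _ => inv_pos.mpr (hF0 r)
  obtain ⟨M, hM, hMs, hMh⟩ := hD.smul hc.le
  refine ⟨fun r => c r • F r, M, fun r => (hF r).smul (inv_pos.mpr (hF0 r)).le, fun r => ?_, hM,
    by rw [hMs, tensorOp_smul], fun μ => ?_, ?_, ?_⟩
  · rw [Matrix.trace_smul, hFtr, Complex.real_smul, ← Complex.ofReal_mul,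
      inv_mul_cancel₀ (hF0 r).ne', Complex.ofReal_one]
  · simp only [tensorOp_smul, map_smul, smul_eq_mul]
    nlinarith [mul_le_mul_of_nonneg_left (hle μ) hc.le]
  -- Writing "some state attains the bound" as a vanishing product turns it into a closed condition,
  -- which survives limits.
  · refine Finset.prod_eq_zero (Finset.mem_univ m) ?_
    simp only [tensorOp_smul, map_smul, smul_eq_mul, hm]
    ring
  · simp only [tensorOp_smul, map_smul, smul_eq_mul]
    nlinarith [mul_lt_mul_of_pos_left hlt hc]

/-- By compactness there is a boundary effect that is discriminated perfectly. -/
lemma exists_perfect_boundary_effect (hρ : ∀ μ, IsState (ρ μ))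
    (hsmall : ∀ ε > 0, ∃ P : Protocol d (root d), ∑ l, guessError ρ (P.leafEffect l) < ε)
    (hN : 1 < N) {χ : ℝ} (hχ : χ ∈ Set.Icc (1 / (N : ℝ)) 1) :
    ∃ (F : ∀ r, Matrix (Fin (d r)) (Fin (d r)) ℂ) (M : Fin N → Matrix (Idx d) (Idx d) ℂ),
      (∀ r, (F r).PosSemidef) ∧ (∀ r, (F r).trace = 1) ∧ (∀ ν, (M ν).PosSemidef) ∧
      ∑ ν, M ν = tensorOp F ∧
      (∀ μ, weight (ρ μ) (tensorOp F) ≤ χ * totalWeight ρ (tensorOp F)) ∧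
      ∏ μ, (weight (ρ μ) (tensorOp F) - χ * totalWeight ρ (tensorOp F)) = 0 ∧
      ∑ ν, (totalWeight ρ (M ν) - weight (ρ ν) (M ν)) ≤ 0 := by
  have hN' : 1 / (N : ℝ) < 1 := by
    rw [div_lt_one (by positivity)]
    exact_mod_cast hN
  -- The error bound `u n` and the threshold `x n` vary together. Shifting `χ` towards `1 / N` keeps
  -- `x n` strictly below 1, which covers the endpoint `χ = 1`.
  let u : ℕ → ℝ := fun n => 1 / ((n : ℝ) + 1)
  let x : ℕ → ℝ := fun n => χ + u n * (1 / (N : ℝ) - χ)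
  have hu0 (n) : 0 < u n := Nat.one_div_pos_of_nat
  have hu1 (n) : u n ≤ 1 := by
    refine (div_le_one (by positivity)).mpr ?_
    linarith [n.cast_nonneg (α := ℝ)]
  have hu : Tendsto u atTop (𝓝 0) := tendsto_one_div_add_atTop_nhds_zero_nat
  have hx : Tendsto x atTop (𝓝 χ) := by
    simpa only [zero_mul, add_zero] using (hu.mul_const (1 / (N : ℝ) - χ)).const_add χ
  have hx0 (n) : 1 / (N : ℝ) ≤ x n := by
    change _ ≤ χ + u n * (1 / (N : ℝ) - χ)
    nlinarith [mul_nonneg (sub_nonneg.mpr (hu1 n)) (sub_nonneg.mpr hχ.1)]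
  have hx1 (n) : x n < 1 := by
    change χ + u n * (1 / (N : ℝ) - χ) < 1
    nlinarith [mul_nonneg (sub_nonneg.mpr (hu1 n)) (sub_nonneg.mpr hχ.2),
      mul_pos (hu0 n) (sub_pos.mpr hN')]
  choose F M hF hF1 hM hMs hle hprod hsum using fun n =>
    exists_normalised_boundary_effect hρ hsmall (hx0 n) (hx1 n) (hu0 n)
  -- The traces of the `M n ν` are nonnegative and add up to the trace of the product, which is 1.
  have hMtr (n ν) : (M n ν).trace.re ≤ 1 := by
    have h1 : ∑ ν, (M n ν).trace.re = 1 := by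
      rw [← Complex.re_sum, ← Matrix.trace_sum, hMs, trace_tensorOp,
        Finset.prod_eq_one fun r _ => hF1 n r, Complex.one_re]
    rw [← h1]
    exact Finset.single_le_sum (f := fun ν => (M n ν).trace.re)
      (fun ν _ => (Complex.nonneg_iff.mp (hM n ν).trace_nonneg).1) (Finset.mem_univ ν)
  have hfc (r) : FirstCountableTopology (Matrix (Fin (d r)) (Fin (d r)) ℂ) :=
    inferInstanceAs (FirstCountableTopology (Fin (d r) → Fin (d r) → ℂ))
  have hfc' : FirstCountableTopology (Matrix (Idx d) (Idx d) ℂ) :=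
    inferInstanceAs (FirstCountableTopology (Idx d → Idx d → ℂ))
  have hK := (isCompact_univ_pi fun r : ι =>
    isCompact_posSemidef_trace_le_one (κ := Fin (d r))).prod
    (isCompact_univ_pi fun _ : Fin N => isCompact_posSemidef_trace_le_one (κ := Idx d))
  obtain ⟨⟨F', M'⟩, ⟨hF', hM'⟩, φ, hφ, hlim⟩ := hK.tendsto_subseq (x := fun n => (F n, M n))
    fun n => ⟨fun r _ => ⟨hF n r, by rw [hF1]; simp⟩, fun ν _ => ⟨hM n ν, hMtr n ν⟩⟩
  have hFlim : Tendsto (fun n => F (φ n)) atTop (𝓝 F') := (continuous_fst.tendsto _).comp hlim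
  have hMlim : Tendsto (fun n => M (φ n)) atTop (𝓝 M') := (continuous_snd.tendsto _).comp hlim
  have hGlim := (continuous_tensorOp.tendsto F').comp hFlim
  have hMνlim (ν) := ((continuous_apply ν).tendsto M').comp hMlim
  have hwlim (μ) := ((continuous_weight (ρ μ)).tendsto _).comp hGlim
  have htlim := ((continuous_totalWeight ρ).tendsto _).comp hGlim
  have hxlim := hx.comp hφ.tendsto_atTop
  refine ⟨F', M', fun r => (hF' r trivial).1, fun r => ?_, fun ν => (hM' ν trivial).1, ?_,
    fun μ => ?_, ?_, ?_⟩
  · have h := ((Continuous.matrix_trace continuous_id).tendsto (F' r)).comp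
      (((continuous_apply r).tendsto F').comp hFlim)
    exact tendsto_nhds_unique h (tendsto_const_nhds.congr fun n => (hF1 (φ n) r).symm)
  · exact tendsto_nhds_unique (tendsto_finsetSum _ fun ν _ => hMνlim ν)
      (hGlim.congr fun n => (hMs (φ n)).symm)
  · exact le_of_tendsto_of_tendsto' (hwlim μ) (hxlim.mul htlim) fun n => hle (φ n) μ
  · exact tendsto_nhds_unique
      (tendsto_finsetProd _ fun μ _ => (hwlim μ).sub (hxlim.mul htlim))
      (tendsto_const_nhds.congr fun n => (hprod (φ n)).symm)
  · refine le_of_tendsto_of_tendsto' (tendsto_finsetSum _ fun ν _ =>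
      (((continuous_totalWeight ρ).tendsto _).comp (hMνlim ν)).sub
        (((continuous_weight (ρ ν)).tendsto _).comp (hMνlim ν)))
      ?_ fun n => hsum (φ n)
    simpa using (hu.comp hφ.tendsto_atTop).mul htlim

end

end AsymptoticLOCC

/-! ### The main theorem -/

theorem proposition1 {ι : Type*} [Fintype ι] [DecidableEq ι] (d : ι → ℕ) (N : ℕ)
    (ρ : Fin N → Matrix (AsymptoticLOCC.Idx d) (AsymptoticLOCC.Idx d) ℂ)
    (hρ : ∀ μ, AsymptoticLOCC.IsState (ρ μ))
    (hker : ∀ v : AsymptoticLOCC.Idx d → ℂ, AsymptoticLOCC.IsProductVector v →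
      (∀ μ, (ρ μ).mulVec v = 0) → v = 0)
    (p : Fin N → ℝ) (hp : ∀ μ, 0 < p μ) (hp1 : ∑ μ, p μ = 1)
    (hd : AsymptoticLOCC.asymptoticMeanFailure p ρ = 0)
    (χ : ℝ) (hχ : χ ∈ Set.Icc (1 / (N : ℝ)) 1) :
    ∃ E : Matrix (AsymptoticLOCC.Idx d) (AsymptoticLOCC.Idx d) ℂ,
      AsymptoticLOCC.IsProductOperator E ∧ E.PosSemidef ∧
      ∑ μ, (E * ρ μ).trace = 1 ∧
      IsGreatest (Set.range fun μ => (E * ρ μ).trace.re) χ ∧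
      ∀ μ ν, μ ≠ ν → (E * ρ μ * E * ρ ν).trace = 0 := by
  open AsymptoticLOCC in
  have hN0 : N ≠ 0 := by rintro rfl; simp at hp1
  have : NeZero N := ⟨hN0⟩
  have hpos (μ) := (hρ μ).1
  -- For a single state `χ = 1` is the only value, no threshold below 1 is available, and the
  -- identity serves directly.
  obtain rfl | hN : N = 1 ∨ 1 < N := by omega
  · have hχ1 : χ = 1 := le_antisymm hχ.2 (by simpa using hχ.1)
    refine ⟨1, ⟨fun _ => 1, tensorOp_one.symm⟩, .one, by simp [(hρ 0).2], ?_,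
      fun μ ν h => absurd (Subsingleton.elim μ ν) h⟩
    simp [(hρ _).2, hχ1]
  obtain ⟨F, M, hF, hF1, hM, hMs, hle, hprod, hsum⟩ := exists_perfect_boundary_effect hρ
    (fun ε hε => exists_protocol_sum_guessError_lt hρ hp hp1 hd hε) hN hχ
  have horth {μ ν} (h : μ ≠ ν) : ρ μ * tensorOp F * ρ ν = 0 :=
    hMs ▸ mul_sum_mul_eq_zero hpos hM hsum h
  have hT := totalWeight_pos hpos hker hF hF1
  -- Without parties the space is one-dimensional and all states equal 1, so two of them cannot be
  -- orthogonal.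
  have hι : Nonempty ι := by
    by_contra hι
    rw [not_nonempty_iff] at hι
    have hone : tensorOp F = 1 := by
      rw [← tensorOp_one]; congr 1; exact Subsingleton.elim _ _
    have h01 := horth (show (⟨0, by omega⟩ : Fin N) ≠ ⟨1, hN⟩ by simp)
    have hρ1 (μ) : ρ μ = 1 := by
      ext i j
      have := (hρ μ).2
      rw [Matrix.trace, Fintype.sum_unique] at this
      rw [Subsingleton.elim i default, Subsingleton.elim j default, Matrix.one_apply_eq]
      exact this
    rw [hρ1, hρ1, hone, Matrix.one_mul, Matrix.one_mul] at h01
    exact one_ne_zero h01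
  set T := totalWeight ρ (tensorOp F) with hTdef
  have hE : (T⁻¹ • tensorOp F).PosSemidef := (posSemidef_tensorOp hF).smul (inv_pos.mpr hT).le
  have hval (μ) : weight (ρ μ) (T⁻¹ • tensorOp F) = T⁻¹ * weight (ρ μ) (tensorOp F) := by
    rw [map_smul, smul_eq_mul]
  refine ⟨T⁻¹ • tensorOp F, isProductOperator_smul _ F, hE, ?_, ⟨?_, ?_⟩, fun μ ν h => ?_⟩
  · simp only [trace_mul_eq_weight (hpos _) hE, hval]
    rw [← Complex.ofReal_sum, ← Finset.mul_sum, ← totalWeight_apply, ← hTdef,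
      inv_mul_cancel₀ hT.ne', Complex.ofReal_one]
  · obtain ⟨μ, -, hμ⟩ := Finset.prod_eq_zero_iff.mp hprod
    refine ⟨μ, ?_⟩
    change weight (ρ μ) (T⁻¹ • tensorOp F) = χ
    rw [hval, sub_eq_zero.mp hμ, mul_comm χ, inv_mul_cancel_left₀ hT.ne']
  · rintro _ ⟨μ, rfl⟩
    change weight (ρ μ) (T⁻¹ • tensorOp F) ≤ χ
    rw [hval, inv_mul_le_iff₀ hT, mul_comm]
    exact hle μ
  · rw [Matrix.mul_assoc _ (ρ μ), Matrix.mul_assoc, Matrix.mul_smul, Matrix.smul_mul _ (ρ μ * _),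
      horth h, smul_zero, Matrix.mul_zero, Matrix.trace_zero]
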